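/- Let $p$ and $q$ be primes with $p \equiv q \equiv 1 \bmod 4$, let $m = pq$, and write $m = 4n+1$ with $n \in \mathbb{Z}$. Consider the negative Pell equation $$ T^2 - TU - nU^2 = -1, $$ or, equivalently, $(2T-U)^2 - mU^2 = -4$, to be solved in integers $T, U$. Let $(\frac{\cdot}{\cdot})$ denote the Legendre symbol. For a prime $\ell \equiv 1 \bmod 4$ and an integer $a$ with $(\frac{a}{\ell}) = +1$, let $(\frac{a}{\ell})_4$ be $+1$ if $a$ is a fourth power modulo $\ell$, and $-1$ otherwise. 1. If $(\frac{p}{q}) = -1$, then the negative Pell equation is solvable. 2. Suppose that $(\frac{p}{q}) = +1$ (so that also $(\frac{q}{p}) = +1$, by quadratic reciprocity). (a) If $(\frac{p}{q})_4 = -(\frac{q}{p})_4$, then the negative Pell equation is not solvable. (b) If $(\frac{p}{q})_4 = (\frac{q}{p})_4 = -1$, then the negative Pell equation is solvable. -/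

import Mathlib

/-- The principal binary quadratic form `Q₀(T, U) = T² - T U - n U²`
of discriminant `4 n + 1`. -/
def principalForm (n T U : ℤ) : ℤ :=
  T ^ 2 - T * U - n * U ^ 2

/-- Integral solvability of the negative Pell equation `Q₀(T, U) = -1` for the
discriminant `m = 4 n + 1`; after multiplication by `4` it reads
`(2 T - U)² - m U² = -4`. -/
def NegativePellSolvable (n : ℤ) : Prop :=
  ∃ T U : ℤ, principalForm n T U = -1

open Classical in
/-- The rational quartic residue symbol `(a/p)₄`, for a prime `p ≡ 1 mod 4` and an integer `a`
with `(a/p) = +1`: it is `+1` if `a` is a fourth power modulo `p`, and `-1` otherwise.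
(It is extended by `0` to the multiples of `p`, and by `-1` to quadratic nonresidues, where it
is not used.) -/
noncomputable def quarticSym (p : ℕ) (a : ℤ) : ℤ :=
  if (a : ZMod p) = 0 then 0
  else if ∃ x : ZMod p, x ^ 4 = (a : ZMod p) then 1
  else -1

open scoped NumberTheorySymbols

/-! Halving the fundamental solution of x² - pq y² = 1 gives consecutive integers with product pq
times a square, so one of s² - pq r² = -1, q s² - p r² = 1, p s² - q r² = 1 is solvable
(`exists_neg_pell_or`). The last two force, respectively, (p/q) = (p/q)₄ = 1 and (q/p) = (q/p)₄ = 1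
(`quarticSym_eq_one_of_pell_form`). Under 1 and 2(b) only the first survives.

For 2(a), let x² - pq y² = -1. Legendre's theorem gives X² = pY² + qZ², so (p/q)₄ = (X/q)(Y/q) and
(q/p)₄ = (X/p)(Z/p). With Y even, reciprocity reduces their product to (-1/X)(2/q). Writing p = a² +
b², the Pell solution shows that w = X + aY is a square mod q, and (X + aY)(X - aY) = (bY)² + qZ²
turns this into w ≡ 1 mod 4. This fixes X mod 4 and makes the product 1. -/

/-! ### Jacobi symbols of divisors of q u² - v². -/

theorem jacobiSym_eq_of_dvd_sub {a b : ℤ} {n : ℕ} (h : (n : ℤ) ∣ a - b) :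
    J(a | n) = J(b | n) :=
  jacobiSym.mod_left' (Int.ModEq.symm (Int.modEq_iff_dvd.2 h))

theorem jacobiSym_neg_one_of_mod_four {q : ℕ} (hq : q % 4 = 1) : J(-1 | q) = 1 := by
  rw [jacobiSym.at_neg_one (Nat.odd_iff.2 (by omega)), ZMod.χ₄_nat_one_mod_four hq]

/-- Quadratic reciprocity for an odd integer and a positive `q ≡ 1 mod 4`. -/
theorem jacobiSym_natAbs_swap {q : ℕ} (hq : q % 4 = 1) {z : ℤ} (hz : Odd z) :
    J(z | q) = J(q | z.natAbs) := by
  have h1 : J(z | q) = J((z.natAbs : ℤ) | q) := by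
    rcases Int.natAbs_eq z with h | h
    · rw [← h]
    · conv_lhs => rw [h, ← neg_one_mul, jacobiSym.mul_left, jacobiSym_neg_one_of_mod_four hq,
        one_mul]
  rw [h1, jacobiSym.quadratic_reciprocity_one_mod_four' (Int.natAbs_odd.2 hz) hq]

theorem jacobiSym_sq_of_isCoprime {v : ℤ} {n : ℕ} (h : IsCoprime v n) : J(v ^ 2 | n) = 1 :=
  jacobiSym.sq_one' (Int.isCoprime_iff_gcd_eq_one.1 h)

/-- If `d u² ≡ v²` modulo `n` with `v` prime to `n`, then `(d/n) = 1`. -/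
theorem jacobiSym_eq_one_of_dvd {d u v : ℤ} {n : ℕ} (h : (n : ℤ) ∣ d * u ^ 2 - v ^ 2)
    (hv : IsCoprime v n) : J(d | n) = 1 := by
  have h1 := jacobiSym_eq_of_dvd_sub h
  rw [jacobiSym_sq_of_isCoprime hv, jacobiSym.mul_left, jacobiSym.pow_left] at h1
  rcases jacobiSym.trichotomy d n with h | h | h
  · simp [h] at h1
  · exact h
  · rw [h] at h1
    nlinarith [sq_nonneg J(u | n)]

theorem isCoprime_of_prime_not_dvd {q : ℕ} [Fact q.Prime] {z : ℤ} (h : ¬ (q : ℤ) ∣ z) :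
    IsCoprime z q :=
  ((Nat.prime_iff_prime_int.1 Fact.out).irreducible.coprime_iff_not_dvd.2 h).symm

theorem jacobiSym_sq_eq_one {q : ℕ} [Fact q.Prime] {z : ℤ} (h : ¬ (q : ℤ) ∣ z) :
    J(z | q) ^ 2 = 1 :=
  jacobiSym.sq_one (Int.isCoprime_iff_gcd_eq_one.1 (isCoprime_of_prime_not_dvd h))

theorem jacobiSym_two_of_mod_eight_one {q : ℕ} (hq : q % 8 = 1) : J(2 | q) = 1 := by
  rw [jacobiSym.at_two (Nat.odd_iff.2 (by omega)), ZMod.χ₈_nat_eq_if_mod_eight,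
    if_neg (by omega), if_pos (by omega)]

theorem jacobiSym_two_of_mod_eight_five {q : ℕ} (hq : q % 8 = 5) : J(2 | q) = -1 := by
  rw [jacobiSym.at_two (Nat.odd_iff.2 (by omega)), ZMod.χ₈_nat_eq_if_mod_eight,
    if_neg (by omega), if_neg (by omega)]

/-- If `q u² ≡ v²` modulo an odd `z` prime to `v`, then `(z/q) = 1`. -/
theorem jacobiSym_eq_one_of_odd {q : ℕ} (hq : q % 4 = 1) {z u v : ℤ} (hz : Odd z)
    (h : z ∣ q * u ^ 2 - v ^ 2) (hv : IsCoprime v z) : J(z | q) = 1 := by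
  rw [jacobiSym_natAbs_swap hq hz]
  refine jacobiSym_eq_one_of_dvd (u := u) (v := v) (Int.natAbs_dvd.2 h) ?_
  rcases Int.natAbs_eq z with h | h
  · rwa [← h]
  · rw [← IsCoprime.neg_right_iff, ← h]; exact hv

/-- With z = 2^k w and w odd, (w/q) = 1, so (2z/q) = (2/q)^(k+1). Either (2/q) = 1, or k = 1 and the
exponent is even. -/
theorem jacobiSym_two_mul_eq_one_of_even {q : ℕ} (hq : q % 4 = 1) {z u v : ℤ}
    (hz0 : z ≠ 0) (hz : Even z) (h8 : q % 8 = 1 ∨ z % 4 = 2)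
    (h : z ∣ q * u ^ 2 - v ^ 2) (hv : IsCoprime v z) : J(2 * z | q) = 1 := by
  obtain ⟨k, w, hw, hk⟩ : ∃ (k : ℕ) (w : ℤ), Odd w ∧ z = 2 ^ k * w := by
    obtain ⟨w, hk, hw⟩ := (Int.finiteMultiplicity_iff.2
      ⟨by decide, hz0⟩ : FiniteMultiplicity 2 z).exists_eq_pow_mul_and_not_dvd
    exact ⟨_, w, Int.not_even_iff_odd.1 (mt Even.two_dvd hw), hk⟩
  have hwz : w ∣ z := ⟨2 ^ k, by rw [hk]; ring⟩
  have hJ : J(w | q) = 1 :=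
    jacobiSym_eq_one_of_odd hq hw (hwz.trans h) (hv.of_isCoprime_of_dvd_right hwz)
  have h2 : J(2 * z | q) = J(2 | q) ^ (k + 1) := by
    rw [hk, ← mul_assoc, jacobiSym.mul_left, hJ, mul_one, ← pow_succ', jacobiSym.pow_left]
  rw [h2]
  rcases h8 with h8 | h8
  · rw [jacobiSym_two_of_mod_eight_one h8, one_pow]
  · have : k = 1 := by
      rcases k with _ | _ | k
      · rw [pow_zero, one_mul] at hk
        subst hk
        exact absurd hz (Int.not_even_iff_odd.2 hw)
      · rfl
      · have h4 : (4 : ℤ) ∣ z := ⟨2 ^ k * w, by rw [hk]; ring⟩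
        omega
    subst this
    exact jacobiSym.sq_one (Nat.coprime_two_left.2 (Nat.odd_iff.2 (by omega)))

/-! ### The quartic symbol, and a descent for (q/w). -/

/-- The square roots of a are ±X/Y, so a is a fourth power iff one of them is a square. As -1 is a
square mod q the sign is irrelevant, and X/Y has the quadratic character of XY. -/
theorem quarticSym_eq_jacobiSym {q : ℕ} [Fact q.Prime] (hq : q % 4 = 1) {a X Y : ℤ}
    (h : (q : ℤ) ∣ X ^ 2 - a * Y ^ 2) (hX : ¬ (q : ℤ) ∣ X) (hY : ¬ (q : ℤ) ∣ Y) :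
    quarticSym q a = J(X | q) * J(Y | q) := by
  have hX' : (X : ZMod q) ≠ 0 := by rwa [Ne, ZMod.intCast_zmod_eq_zero_iff_dvd]
  have hY' : (Y : ZMod q) ≠ 0 := by rwa [Ne, ZMod.intCast_zmod_eq_zero_iff_dvd]
  have h' : (X : ZMod q) ^ 2 = a * (Y : ZMod q) ^ 2 := by
    rw [← sub_eq_zero]
    exact_mod_cast (ZMod.intCast_zmod_eq_zero_iff_dvd _ q).2 h
  have ha : (a : ZMod q) ≠ 0 := by
    rintro h0
    rw [h0, zero_mul] at h'
    exact hX' (pow_eq_zero_iff two_ne_zero |>.1 h')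
  obtain ⟨i, hi⟩ := ZMod.exists_sq_eq_neg_one_iff.2 (show q % 4 ≠ 3 by omega)
  have hXY : ((X * Y : ℤ) : ZMod q) ≠ 0 := by push_cast; exact mul_ne_zero hX' hY'
  rw [quarticSym, if_neg ha, ← jacobiSym.mul_left, ← jacobiSym.legendreSym.to_jacobiSym]
  have key : (∃ x : ZMod q, x ^ 4 = a) ↔ IsSquare ((X * Y : ℤ) : ZMod q) := by
    push_cast
    constructor
    · rintro ⟨x, hx⟩
      have : (X - x ^ 2 * Y : ZMod q) * (X + x ^ 2 * Y) = 0 := by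
        linear_combination h' - hx * (Y : ZMod q) ^ 2
      rcases mul_eq_zero.1 this with h0 | h0
      · exact ⟨x * Y, by linear_combination h0 * Y⟩
      · exact ⟨i * x * Y, by linear_combination h0 * Y + hi * x ^ 2 * Y ^ 2⟩
    · rintro ⟨s, hs⟩
      refine ⟨s / Y, ?_⟩
      field_simp
      linear_combination (-(s ^ 2) - X * Y) * hs + (Y : ZMod q) ^ 2 * h'
  by_cases hs : IsSquare ((X * Y : ℤ) : ZMod q)
  · rw [if_pos (key.2 hs), (legendreSym.eq_one_iff q hXY).2 hs]
  · rw [if_neg (mt key.1 hs), (legendreSym.eq_neg_one_iff q).2 hs]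

/-- If `s² + q t² = w w'` and no prime divides `w`, `w'` and `t`, then `(q/w) = (-1/w)`. -/
theorem jacobiSym_eq_neg_one_of_mul_eq {q : ℕ} (w : ℕ) : ∀ (w' s t : ℤ), Odd w → Nat.Coprime w q →
    (w : ℤ) * w' = s ^ 2 + q * t ^ 2 →
    (∀ l : ℕ, l.Prime → l ∣ w → (l : ℤ) ∣ t → ¬ (l : ℤ) ∣ w') → J(q | w) = J(-1 | w) := by
  induction w using Nat.strong_induction_on with
  | _ w ih =>
    intro w' s t hw hwq h hl
    -- If t is prime to w, then -q is a square mod w. Otherwise a common prime l divides s too but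
    -- not w', so l² ∣ w. Dividing w by l² changes neither symbol.
    by_cases hc : IsCoprime t w
    · have hqw : IsCoprime (q : ℤ) w := Nat.isCoprime_iff_coprime.2 hwq.symm
      have hs : IsCoprime s w := by
        have h1 : IsCoprime ((q : ℤ) * t ^ 2) w := hqw.mul_left hc.pow_left
        have h2 : IsCoprime (s ^ 2) (w : ℤ) := by
          have : s ^ 2 = -((q : ℤ) * t ^ 2) + w * w' := by rw [h]; ring
          rw [this]
          exact h1.neg_left.add_mul_left_left w'
        exact (IsCoprime.pow_left_iff two_pos).1 h2
      have h1 : J(-(q : ℤ) | w) = 1 :=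
        jacobiSym_eq_one_of_dvd (u := t) (v := s) ⟨-w', by linear_combination h⟩ hs
      rw [← neg_one_mul, jacobiSym.mul_left] at h1
      rcases jacobiSym.trichotomy (-1) w with h0 | h0 | h0 <;> rw [h0] at h1 ⊢ <;> linarith
    · obtain ⟨l, hlp, hlt, hlw⟩ : ∃ l : ℕ, l.Prime ∧ (l : ℤ) ∣ t ∧ l ∣ w := by
        rw [Int.isCoprime_iff_gcd_eq_one] at hc
        obtain ⟨l, hlp, hld⟩ := Nat.exists_prime_and_dvd hc
        exact ⟨l, hlp, Int.natCast_dvd.2 (hld.trans (Nat.gcd_dvd_left _ _)),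
          hld.trans (Nat.gcd_dvd_right _ _)⟩
      have hpl : Prime (l : ℤ) := Nat.prime_iff_prime_int.1 hlp
      have hlw' := hl l hlp hlw hlt
      have hls : (l : ℤ) ∣ s := by
        refine hpl.dvd_of_dvd_pow (n := 2) ?_
        have : s ^ 2 = w * w' - q * t * t := by rw [h]; ring
        rw [this]
        exact dvd_sub ((Int.natCast_dvd_natCast.2 hlw).mul_right _) (hlt.mul_left _)
      obtain ⟨t, rfl⟩ := hlt
      obtain ⟨s, rfl⟩ := hls
      have h2 : l ^ 2 ∣ w := by
        rw [← Int.natCast_dvd_natCast]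
        push_cast
        have hc : IsCoprime ((l : ℤ) ^ 2) w' :=
          (hpl.irreducible.coprime_iff_not_dvd.2 hlw').pow_left
        exact hc.dvd_of_dvd_mul_right ⟨s ^ 2 + q * t ^ 2, by rw [h]; ring⟩
      obtain ⟨v, rfl⟩ := h2
      have hl0 : (l : ℤ) ≠ 0 := hpl.ne_zero
      have hv : Odd v := (Nat.odd_mul.1 hw).2
      have hv0 : 0 < v := hv.pos
      have hlq : Nat.Coprime l q := hwq.coprime_dvd_left hlw
      have hlt : v < l ^ 2 * v := lt_mul_left hv0 (Nat.one_lt_pow two_ne_zero hlp.one_lt)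
      have := ih v hlt w' s t hv (hwq.coprime_dvd_left ⟨l ^ 2, by ring⟩)
        (mul_left_cancel₀ (pow_ne_zero 2 hl0) (by push_cast at h; linear_combination h))
        (fun r hr hrv hrt => hl r hr (hrv.mul_left _) (hrt.mul_left _))
      have hne : l ^ 2 ≠ 0 := by exact_mod_cast pow_ne_zero 2 hl0
      rw [jacobiSym.mul_right' _ hne hv0.ne', jacobiSym.mul_right' _ hne hv0.ne', this,
        jacobiSym.pow_right, jacobiSym.pow_right, jacobiSym.sq_one, jacobiSym.sq_one]
      · simp
      · exact Int.isCoprime_iff_gcd_eq_one.1 (Nat.isCoprime_iff_coprime.2 hlq.symm)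

/-! ### The three equations arising from the fundamental Pell solution. -/

theorem exists_sq_of_mul_eq_sq {a b c : ℤ} (ha : 0 ≤ a) (hb : 0 ≤ b) (hab : IsCoprime a b)
    (h : a * b = c ^ 2) : ∃ r s : ℤ, a = r ^ 2 ∧ b = s ^ 2 := by
  have aux : ∀ {x y : ℤ}, 0 ≤ x → IsCoprime x y → x * y = c ^ 2 → ∃ r : ℤ, x = r ^ 2 := by
    intro x y hx hxy hc
    obtain ⟨r, hr | hr⟩ := Int.sq_of_gcd_eq_one (Int.isCoprime_iff_gcd_eq_one.1 hxy) hc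
    · exact ⟨r, hr⟩
    -- Here x = -r² and x ≥ 0, so x = 0.
    · exact ⟨0, by nlinarith [sq_nonneg r]⟩
  obtain ⟨r, hr⟩ := aux ha hab h
  obtain ⟨s, hs⟩ := aux hb hab.symm (by rw [mul_comm, h])
  exact ⟨r, s, hr, hs⟩

/-- The possible shapes of consecutive integers whose product is `p q` times a square. -/
theorem exists_of_mul_succ_eq {p q : ℕ} (hp : p.Prime) (hq : q.Prime) {k y : ℤ} (hk : 0 < k)
    (h : k * (k + 1) = p * q * y ^ 2) :
    ∃ r s : ℤ, (k = r ^ 2 ∧ k + 1 = p * q * s ^ 2) ∨ (k = p * q * r ^ 2 ∧ k + 1 = s ^ 2) ∨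
      (k = p * r ^ 2 ∧ k + 1 = q * s ^ 2) ∨ (k = q * r ^ 2 ∧ k + 1 = p * s ^ 2) := by
  have hpz := Nat.prime_iff_prime_int.1 hp
  have hqz := Nat.prime_iff_prime_int.1 hq
  have hp0 : (0 : ℤ) < p := by exact_mod_cast hp.pos
  have hq0 : (0 : ℤ) < q := by exact_mod_cast hq.pos
  have hc : IsCoprime k (k + 1) := ⟨-1, 1, by ring⟩
  have split : ∀ {d e a b : ℤ}, 0 < d → 0 < e → d * e = p * q → k = d * a → k + 1 = e * b →
      ∃ r s : ℤ, a = r ^ 2 ∧ b = s ^ 2 := by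
    intro d e a b hd he hde ha hb
    refine exists_sq_of_mul_eq_sq (c := y) ?_ ?_ ?_ ?_
    · exact (pos_of_mul_pos_right (ha ▸ hk) hd.le).le
    · exact (pos_of_mul_pos_right (hb ▸ (by omega : 0 < k + 1)) he.le).le
    · exact (hc.of_isCoprime_of_dvd_left ⟨d, by rw [ha]; ring⟩).of_isCoprime_of_dvd_right
        ⟨e, by rw [hb]; ring⟩
    · refine mul_left_cancel₀ (mul_pos hd he).ne' ?_
      calc d * e * (a * b) = d * a * (e * b) := by ring
        _ = d * e * y ^ 2 := by rw [← ha, ← hb, h, hde]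
  have key : ∀ {d : ℤ}, IsCoprime d (k + 1) → d ∣ p * q → d ∣ k := by
    rintro d hd ⟨e, he⟩
    exact hd.dvd_of_dvd_mul_right (h ▸ ⟨e * y ^ 2, by rw [he]; ring⟩)
  have key' : ∀ {d : ℤ}, IsCoprime d k → d ∣ p * q → d ∣ k + 1 := by
    rintro d hd ⟨e, he⟩
    exact hd.dvd_of_dvd_mul_left (h ▸ ⟨e * y ^ 2, by rw [he]; ring⟩)
  rcases hpz.dvd_or_dvd (h ▸ ⟨q * y ^ 2, by ring⟩ : (p : ℤ) ∣ k * (k + 1)) with h1 | h1 <;>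
    rcases hqz.dvd_or_dvd (h ▸ ⟨p * y ^ 2, by ring⟩ : (q : ℤ) ∣ k * (k + 1)) with h2 | h2
  · obtain ⟨a, ha⟩ := key ((hc.of_isCoprime_of_dvd_left h1).mul_left
      (hc.of_isCoprime_of_dvd_left h2)) dvd_rfl
    obtain ⟨r, s, rfl, hs⟩ := split (mul_pos hp0 hq0) one_pos (mul_one _) ha (one_mul _).symm
    exact ⟨r, s, .inr (.inl ⟨ha, hs⟩)⟩
  · obtain ⟨a, ha⟩ := h1
    obtain ⟨b, hb⟩ := h2
    obtain ⟨r, s, rfl, rfl⟩ := split hp0 hq0 rfl ha hb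
    exact ⟨r, s, .inr (.inr (.inl ⟨ha, hb⟩))⟩
  · obtain ⟨a, ha⟩ := h2
    obtain ⟨b, hb⟩ := h1
    obtain ⟨r, s, rfl, rfl⟩ := split hq0 hp0 (mul_comm _ _) ha hb
    exact ⟨r, s, .inr (.inr (.inr ⟨ha, hb⟩))⟩
  · obtain ⟨a, ha⟩ := key' ((hc.symm.of_isCoprime_of_dvd_left h1).mul_left
      (hc.symm.of_isCoprime_of_dvd_left h2)) dvd_rfl
    obtain ⟨r, s, hr, rfl⟩ := split one_pos (mul_pos hp0 hq0) (one_mul _) (one_mul _).symm ha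
    exact ⟨r, s, .inl ⟨hr, ha⟩⟩

theorem not_isSquare_mul_of_prime {p q : ℕ} (hp : p.Prime) (hq : q.Prime) (hpq : p ≠ q) :
    ¬ IsSquare ((p : ℤ) * q) := by
  rintro ⟨r, hr⟩
  have hpz := Nat.prime_iff_prime_int.1 hp
  have hpr : (p : ℤ) ∣ r := by
    rcases hpz.dvd_or_dvd (hr ▸ dvd_mul_right _ _) with h | h <;> exact h
  obtain ⟨t, rfl⟩ := hpr
  have : (q : ℤ) = p * (t * t) := mul_left_cancel₀ hpz.ne_zero (by rw [hr]; ring)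
  have : p ∣ q := Int.natCast_dvd_natCast.1 ⟨_, this⟩
  exact hpq ((Nat.prime_dvd_prime_iff_eq hp hq).1 this)

/-- For primes `p ≠ q` congruent to `1` mod `4`, one of the equations `s² - p q r² = -1`,
`q s² - p r² = 1`, `p s² - q r² = 1` is solvable. -/
theorem exists_neg_pell_or {p q : ℕ} (hp : p.Prime) (hq : q.Prime) (hpq : p ≠ q)
    (hp4 : p % 4 = 1) (hq4 : q % 4 = 1) :
    ∃ r s : ℤ, s ^ 2 - p * q * r ^ 2 = -1 ∨ q * s ^ 2 - p * r ^ 2 = 1 ∨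
      p * s ^ 2 - q * r ^ 2 = 1 := by
  have hp0 : (0 : ℤ) < p := by exact_mod_cast hp.pos
  have hq0 : (0 : ℤ) < q := by exact_mod_cast hq.pos
  obtain ⟨a, ha1, -, hmin⟩ := Pell.IsFundamental.exists_of_not_isSquare (mul_pos hp0 hq0)
    (not_isSquare_mul_of_prime hp hq hpq)
  have hprop := a.prop
  set x := a.x
  set y := a.y
  have hpq4 : ((p : ℤ) * q) % 4 = 1 := by
    have : (p * q) % 4 = 1 := by rw [Nat.mul_mod, hp4, hq4]
    exact_mod_cast this
  have hy : Even y := by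
    by_contra hy
    have h1 := Int.sq_mod_four_eq_one_of_odd (Int.not_even_iff_odd.1 hy)
    have h2 : (p * q * y ^ 2 : ℤ) % 4 = 1 := by rw [Int.mul_emod, hpq4, h1]; rfl
    rcases Int.even_or_odd' x with ⟨z, hz | hz⟩ <;> rw [hz] at hprop <;> ring_nf at hprop h2 <;>
      omega
  have hx : Odd x := by
    by_contra hx
    obtain ⟨z, hz⟩ := Int.not_odd_iff_even.1 hx
    obtain ⟨w, hw⟩ := hy
    rw [hz, hw] at hprop
    have : 2 * (2 * z ^ 2 - 2 * (p * q * w ^ 2)) = 1 := by linear_combination hprop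
    omega
  obtain ⟨k, hk⟩ := hx
  obtain ⟨w, hw⟩ := hy
  have hkk : k * (k + 1) = p * q * w ^ 2 := by
    rw [hk, hw] at hprop
    linarith
  obtain ⟨r, s, h | h | h | h⟩ := exists_of_mul_succ_eq hp hq (by omega) hkk
  · exact ⟨s, r, .inl (by linarith [h.1, h.2])⟩
  -- Here s² - pq r² = 1 while x = 2k + 1 = 2s² - 1 > |s|, contradicting minimality of the
  -- fundamental solution.
  · exfalso
    have hs : |s| ^ 2 - p * q * r ^ 2 = 1 := by rw [sq_abs]; linarith [h.1, h.2]
    have h1 : 1 < |s| := by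
      by_contra! hs1
      have := sq_abs s
      nlinarith [abs_nonneg s, h.2]
    have h2 := hmin (b := Pell.Solution₁.mk |s| r hs) (by simpa using h1)
    rw [Pell.Solution₁.x_mk] at h2
    nlinarith [h.2, sq_abs s]
  · exact ⟨r, s, .inr (.inl (by linarith [h.1, h.2]))⟩
  · exact ⟨r, s, .inr (.inr (by linarith [h.1, h.2]))⟩

/-- Modulo 4, s is odd and r even. Then s² ≡ 1 mod 8 gives a ≡ 1 + b r² mod 8. This supplies the
2-adic hypothesis of `jacobiSym_two_mul_eq_one_of_even`. -/
theorem even_of_mul_sq_sub_mul_sq_eq_one {a b r s : ℤ} (ha : a % 4 = 1) (hb : b % 4 = 1)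
    (h : a * s ^ 2 - b * r ^ 2 = 1) : Even r ∧ (a % 8 = 1 ∨ r % 4 = 2) := by
  obtain ⟨u, hu⟩ : ∃ u, a = 4 * u + 1 := ⟨a / 4, by omega⟩
  obtain ⟨v, hv⟩ : ∃ v, b = 4 * v + 1 := ⟨b / 4, by omega⟩
  subst hu hv
  rcases Int.even_or_odd' s with ⟨x, rfl | rfl⟩ <;> rcases Int.even_or_odd' r with ⟨y, rfl | rfl⟩
  · have : 2 * (2 * ((4 * u + 1) * x ^ 2 - (4 * v + 1) * y ^ 2)) = 1 := by linear_combination h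
    omega
  · have : 4 * ((4 * u + 1) * x ^ 2 - (4 * v + 1) * (y ^ 2 + y) - v) = 2 := by
      linear_combination h
    omega
  · refine ⟨even_two_mul y, ?_⟩
    obtain ⟨c, hc⟩ := Int.even_mul_succ_self x
    have h1 : u + 2 * (c * (4 * u + 1)) = (4 * v + 1) * y ^ 2 := by
      refine mul_left_cancel₀ (four_ne_zero : (4 : ℤ) ≠ 0) ?_
      linear_combination h - 4 * (4 * u + 1) * hc
    rcases Int.even_or_odd' y with ⟨z, rfl | rfl⟩
    · have : u = 2 * ((4 * v + 1) * (2 * z ^ 2) - c * (4 * u + 1)) := by linear_combination h1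
      omega
    · omega
  · have : 2 * (2 * ((4 * u + 1) * (x ^ 2 + x) + u - (4 * v + 1) * (y ^ 2 + y) - v)) = 1 := by
      linear_combination h
    omega

/-- Solvability of `p s² - q r² = 1` makes `q` a fourth power residue modulo `p`. -/
theorem quarticSym_eq_one_of_pell_form {p q : ℕ} [Fact p.Prime] (hp4 : p % 4 = 1)
    (hq4 : q % 4 = 1) {r s : ℤ} (h : p * s ^ 2 - q * r ^ 2 = 1) :
    J(q | p) = 1 ∧ quarticSym p q = 1 := by
  have hpz := Nat.prime_iff_prime_int.1 (Fact.out : p.Prime)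
  have hp2 := (Fact.out : p.Prime).two_le
  constructor
  · have h1 : J(-(q : ℤ) | p) = 1 :=
      jacobiSym_eq_one_of_dvd (u := r) (v := 1) ⟨-s ^ 2, by linear_combination h⟩ isCoprime_one_left
    rwa [← neg_one_mul, jacobiSym.mul_left, jacobiSym_neg_one_of_mod_four hp4, one_mul] at h1
  -- With i² ≡ -1 mod p, the equation reads q r² ≡ i², so (q/p)₄ = (i/p)(r/p). Both (2i/p) and
  -- (2r/p) are 1: 2i ≡ (1 + i)² mod p, and p s² ≡ 1 mod r.
  · obtain ⟨j, hj⟩ := ZMod.exists_sq_eq_neg_one_iff.2 (show p % 4 ≠ 3 by omega)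
    obtain ⟨i, rfl⟩ := ZMod.intCast_surjective j
    have hi : (p : ℤ) ∣ i ^ 2 + 1 := by
      rw [← ZMod.intCast_zmod_eq_zero_iff_dvd]
      push_cast
      rw [pow_two, ← hj]; ring
    have hpi : ¬ (p : ℤ) ∣ i := fun h0 => hpz.not_dvd_one (by
      have : (1 : ℤ) = i ^ 2 + 1 - i * i := by ring
      rw [this]
      exact dvd_sub hi (h0.mul_left i))
    have hpr : ¬ (p : ℤ) ∣ r := by
      rintro ⟨t, rfl⟩
      exact hpz.not_dvd_one ⟨s ^ 2 - q * p * t ^ 2, by linear_combination -h⟩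
    have hp4' : (p : ℤ) % 4 = 1 := by omega
    have hq4' : (q : ℤ) % 4 = 1 := by omega
    have hsr : Even r ∧ (p % 8 = 1 ∨ r % 4 = 2) := by
      obtain ⟨h1, h2⟩ := even_of_mul_sq_sub_mul_sq_eq_one hp4' hq4' h
      exact ⟨h1, h2.imp_left fun h2 => by omega⟩
    have hr0 : r ≠ 0 := by rintro rfl; exact hpr (dvd_zero _)
    have h2r : J(2 * r | p) = 1 :=
      jacobiSym_two_mul_eq_one_of_even hp4 hr0 hsr.1 hsr.2 (u := s) (v := 1)
        ⟨q * r, by linear_combination h⟩ isCoprime_one_left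
    have h2i : J(2 * i | p) = 1 := by
      rw [jacobiSym_eq_of_dvd_sub (b := (1 + i) ^ 2) (hi.trans ⟨-1, by ring⟩)]
      refine jacobiSym_sq_of_isCoprime (isCoprime_of_prime_not_dvd fun h1 => ?_)
      have h2 : (p : ℤ) ∣ 2 := by
        have : (2 : ℤ) = (i ^ 2 + 1) - (i - 1) * (1 + i) := by ring
        rw [this]
        exact dvd_sub hi (h1.mul_left _)
      have := Int.le_of_dvd two_pos h2
      omega
    have h22 : J(2 | p) ^ 2 = 1 := jacobiSym.sq_one (Nat.coprime_two_left.2 (Nat.odd_iff.2 (by omega)))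
    rw [quarticSym_eq_jacobiSym hp4 (X := i) (Y := r) ?_ hpi hpr]
    · rw [jacobiSym.mul_left] at h2r h2i
      calc J(i | p) * J(r | p) = J(2 | p) ^ 2 * (J(i | p) * J(r | p)) := by rw [h22, one_mul]
        _ = (J(2 | p) * J(i | p)) * (J(2 | p) * J(r | p)) := by ring
        _ = 1 := by rw [h2r, h2i, one_mul]
    · have : i ^ 2 - q * r ^ 2 = (i ^ 2 + 1) - p * s ^ 2 := by linear_combination h
      rw [this]
      exact dvd_sub hi (dvd_mul_right _ _)

/-! ### Legendre's theorem for X² = pY² + qZ². -/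

theorem natCast_not_dvd_natCast_of_prime_ne {p q : ℕ} (hp : p.Prime) (hq : q.Prime)
    (hpq : p ≠ q) : ¬ (p : ℤ) ∣ q := fun h =>
  hpq ((Nat.prime_dvd_prime_iff_eq hp hq).1 (Int.natCast_dvd_natCast.1 h))

theorem exists_dvd_sq_sub_of_jacobiSym_eq_one {p : ℕ} [Fact p.Prime] {a : ℤ} (h : J(a | p) = 1) :
    ∃ r : ℤ, (p : ℤ) ∣ r ^ 2 - a := by
  obtain ⟨s, hs⟩ := ZMod.isSquare_of_jacobiSym_eq_one h
  obtain ⟨r, rfl⟩ := ZMod.intCast_surjective s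
  refine ⟨r, (ZMod.intCast_zmod_eq_zero_iff_dvd _ p).1 ?_⟩
  push_cast
  rw [hs]; ring

/-- Thue's lemma for two simultaneous congruences modulo distinct primes. -/
theorem exists_small_of_congruences {p q : ℕ} [Fact p.Prime] [Fact q.Prime] (hpq : p ≠ q)
    (α β : ℤ) : ∃ X Y Z : ℤ, ¬ (X = 0 ∧ Y = 0 ∧ Z = 0) ∧ X ^ 2 < p * q ∧ Y ^ 2 < q ∧ Z ^ 2 < p ∧
      (q : ℤ) ∣ X - α * Y ∧ (p : ℤ) ∣ X - β * Z := by
  have hpp : p.Prime := Fact.out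
  have hqp : q.Prime := Fact.out
  -- The box has more than √(pq)·√q·√p = pq points, so two of them share their residues.
  let S : Finset (ℕ × ℕ × ℕ) := Finset.range ((p * q).sqrt + 1) ×ˢ
    Finset.range (q.sqrt + 1) ×ˢ Finset.range (p.sqrt + 1)
  let f : ℕ × ℕ × ℕ → ZMod q × ZMod p := fun t => (t.1 - α * t.2.1, t.1 - β * t.2.2)
  have hcard : (Finset.univ : Finset (ZMod q × ZMod p)).card < S.card := by
    rw [Finset.card_univ, Fintype.card_prod, ZMod.card, ZMod.card]
    simp only [S, Finset.card_product, Finset.card_range]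
    have h1 := Nat.lt_succ_sqrt' (p * q)
    have h2 := Nat.lt_succ_sqrt' q
    have h3 := Nat.lt_succ_sqrt' p
    refine lt_of_pow_lt_pow_left₀ 2 (Nat.zero_le _) ?_
    calc (q * p) ^ 2 = (p * q) * (q * p) := by ring
      _ < ((p * q).sqrt + 1) ^ 2 * ((q.sqrt + 1) ^ 2 * (p.sqrt + 1) ^ 2) := by gcongr
      _ = _ := by ring
  obtain ⟨⟨x, y, z⟩, ht, ⟨x', y', z'⟩, ht', hne, hf⟩ :=
    Finset.exists_ne_map_eq_of_card_lt_of_maps_to hcard (f := f) (fun _ _ => Finset.mem_univ _)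
  simp only [S, Finset.mem_range,
    Finset.mem_product, Nat.lt_succ_iff] at ht ht'
  simp only [f, Prod.mk.injEq] at hf
  -- The bounds are strict because p, q and pq are not squares.
  have bound : ∀ {n u v : ℕ}, ¬ IsSquare (n : ℤ) → u ≤ n.sqrt → v ≤ n.sqrt →
      ((u : ℤ) - v) ^ 2 < n := by
    intro n u v hn hu hv
    refine lt_of_le_of_ne ?_ fun h => hn ⟨_, by rw [← h, pow_two]⟩
    have h1 : ((n.sqrt : ℤ)) ^ 2 ≤ n := by exact_mod_cast Nat.sqrt_le' n
    have hu' : (u : ℤ) ≤ n.sqrt := by exact_mod_cast hu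
    have hv' : (v : ℤ) ≤ n.sqrt := by exact_mod_cast hv
    refine le_trans (sq_le_sq' ?_ ?_) h1 <;> linarith [Int.natCast_nonneg u, Int.natCast_nonneg v]
  refine ⟨x - x', y - y', z - z', ?_, ?_, ?_, ?_, ?_, ?_⟩
  · rintro ⟨h1, h2, h3⟩
    apply hne
    simp only [Prod.mk.injEq]
    omega
  · have := bound (n := p * q) (by push_cast; exact not_isSquare_mul_of_prime hpp hqp hpq)
      ht.1 ht'.1
    exact_mod_cast this
  · exact bound (Nat.prime_iff_prime_int.1 hqp).irreducible.not_isSquare ht.2.1 ht'.2.1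
  · exact bound (Nat.prime_iff_prime_int.1 hpp).irreducible.not_isSquare ht.2.2 ht'.2.2
  · rw [← ZMod.intCast_zmod_eq_zero_iff_dvd]
    push_cast
    linear_combination hf.1
  · rw [← ZMod.intCast_zmod_eq_zero_iff_dvd]
    push_cast
    linear_combination hf.2

/-- Legendre's theorem for the form `X² - p Y² - q Z²`. -/
theorem exists_sq_eq_prime_mul_sq_add {p q : ℕ} [Fact p.Prime] [Fact q.Prime] (hpq : p ≠ q)
    (h1 : J(p | q) = 1) (h2 : J(q | p) = 1) :
    ∃ X Y Z : ℤ, ¬ (X = 0 ∧ Y = 0 ∧ Z = 0) ∧ X ^ 2 = p * Y ^ 2 + q * Z ^ 2 := by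
  have hpz := Nat.prime_iff_prime_int.1 (Fact.out : p.Prime)
  have hqz := Nat.prime_iff_prime_int.1 (Fact.out : q.Prime)
  have hp0 : (0 : ℤ) < p := by exact_mod_cast (Fact.out : p.Prime).pos
  have hq0 : (0 : ℤ) < q := by exact_mod_cast (Fact.out : q.Prime).pos
  obtain ⟨α, hα⟩ := exists_dvd_sq_sub_of_jacobiSym_eq_one h1
  obtain ⟨β, hβ⟩ := exists_dvd_sq_sub_of_jacobiSym_eq_one h2
  obtain ⟨X, Y, Z, h0, hX, hY, hZ, hq, hp⟩ := exists_small_of_congruences hpq α β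
  have hc : IsCoprime (p : ℤ) q := hpz.irreducible.coprime_iff_not_dvd.2
    (natCast_not_dvd_natCast_of_prime_ne Fact.out Fact.out hpq)
  have hd : (p : ℤ) * q ∣ X ^ 2 - p * Y ^ 2 - q * Z ^ 2 := by
    refine hc.mul_dvd ?_ ?_
    · have : X ^ 2 - p * Y ^ 2 - q * Z ^ 2 =
        (X - β * Z) * (X + β * Z) + (β ^ 2 - q) * Z ^ 2 - p * Y ^ 2 := by ring
      rw [this]
      exact dvd_sub (dvd_add (hp.mul_right _) (hβ.mul_right _)) (dvd_mul_right _ _)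
    · have : X ^ 2 - p * Y ^ 2 - q * Z ^ 2 =
        (X - α * Y) * (X + α * Y) + (α ^ 2 - p) * Y ^ 2 - q * Z ^ 2 := by ring
      rw [this]
      exact dvd_sub (dvd_add (hq.mul_right _) (hα.mul_right _)) (dvd_mul_right _ _)
  obtain ⟨k, hk⟩ := hd
  have hpq0 : (0 : ℤ) < p * q := mul_pos hp0 hq0
  have hY' : (p : ℤ) * Y ^ 2 < p * q := by gcongr
  have hZ' : (q : ℤ) * Z ^ 2 < p * q := by rw [mul_comm (p : ℤ)]; gcongr
  have hk1 : k < 1 := by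
    refine lt_of_mul_lt_mul_left (a := (p : ℤ) * q) ?_ hpq0.le
    nlinarith [sq_nonneg Y, sq_nonneg Z]
  have hk2 : -2 < k := by
    refine lt_of_mul_lt_mul_left (a := (p : ℤ) * q) ?_ hpq0.le
    nlinarith [sq_nonneg X]
  obtain rfl | rfl : k = 0 ∨ k = -1 := by omega
  · exact ⟨X, Y, Z, h0, by linarith⟩
  -- Here X² - pY² = q(Z² - p). Multiplying by Z² - p, the norm of Z + √p, gives the witness from (X
  -- + Y√p)(Z + √p).
  · refine ⟨X * Z + p * Y, X + Y * Z, Z ^ 2 - p, ?_, by linear_combination (Z ^ 2 - p) * hk⟩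
    rintro ⟨-, -, h⟩
    exact hpz.irreducible.not_isSquare ⟨Z, by linarith⟩

/-- Dividing by g = gcd(X, Y) is possible because g² ∣ qZ² and q is prime, so g ∣ Z. A prime then
dividing X and Z would have its square dividing p. -/
theorem exists_coprime_sq_eq_prime_mul_sq_add {p q : ℕ} [Fact p.Prime] [Fact q.Prime]
    (hpq : p ≠ q) (h1 : J(p | q) = 1) (h2 : J(q | p) = 1) :
    ∃ (X : ℕ) (Y Z : ℤ), (X : ℤ) ^ 2 = p * Y ^ 2 + q * Z ^ 2 ∧ IsCoprime (X : ℤ) Y ∧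
      IsCoprime (X : ℤ) Z := by
  have hpz := Nat.prime_iff_prime_int.1 (Fact.out : p.Prime)
  have hqz := Nat.prime_iff_prime_int.1 (Fact.out : q.Prime)
  obtain ⟨X, Y, Z, h0, h⟩ := exists_sq_eq_prime_mul_sq_add hpq h1 h2
  have hXY : Int.gcd X Y ≠ 0 := by
    intro hg
    obtain ⟨rfl, rfl⟩ := Int.gcd_eq_zero_iff.1 hg
    refine h0 ⟨rfl, rfl, ?_⟩
    have : (q : ℤ) * Z ^ 2 = 0 := by linarith
    exact pow_eq_zero_iff two_ne_zero |>.1 ((mul_eq_zero.1 this).resolve_left hqz.ne_zero)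
  obtain ⟨g, X', Y', hgpos, hco, rfl, rfl⟩ := Int.exists_gcd_one' (Nat.pos_of_ne_zero hXY)
  rw [← Int.isCoprime_iff_gcd_eq_one] at hco
  have hg0 : (g : ℤ) ≠ 0 := by exact_mod_cast hgpos.ne'
  obtain ⟨t, ht⟩ : (g : ℤ) ∣ q * Z :=
    (Int.pow_dvd_pow_iff two_ne_zero).1 ⟨q * (X' ^ 2 - p * Y' ^ 2), by linear_combination -q * h⟩
  obtain ⟨u, rfl⟩ : (q : ℤ) ∣ t := by
    refine hqz.dvd_of_dvd_pow (n := 2) ⟨X' ^ 2 - p * Y' ^ 2, ?_⟩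
    refine mul_left_cancel₀ (pow_ne_zero 2 hg0) ?_
    linear_combination -q * h - (q * Z + g * t) * ht
  obtain rfl : Z = g * u := mul_left_cancel₀ hqz.ne_zero (by linear_combination ht)
  have hX2 : X' ^ 2 = p * Y' ^ 2 + q * u ^ 2 :=
    mul_left_cancel₀ (pow_ne_zero 2 hg0) (by linear_combination h)
  have hcoZ : IsCoprime X' u := by
    refine isCoprime_of_prime_dvd ?_ ?_
    · rintro ⟨rfl, rfl⟩
      have : (p : ℤ) * Y' ^ 2 = 0 := by linarith
      have : Y' = 0 :=
        pow_eq_zero_iff two_ne_zero |>.1 ((mul_eq_zero.1 this).resolve_left hpz.ne_zero)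
      rw [this] at hco
      exact not_isCoprime_zero_zero hco
    · rintro l hl ⟨x, rfl⟩ ⟨z, rfl⟩
      have hlY : IsCoprime (l ^ 2) (Y' ^ 2) := (hco.of_mul_left_left).pow
      have h3 : l ^ 2 ∣ p :=
        hlY.dvd_of_dvd_mul_right ⟨x ^ 2 - q * z ^ 2, by linear_combination -hX2⟩
      rw [pow_two] at h3
      exact hl.not_isUnit (hpz.irreducible.squarefree l h3)
  refine ⟨X'.natAbs, Y', u, by rw [Int.natAbs_sq, hX2], ?_, ?_⟩ <;>
    rwa [Int.natCast_natAbs, IsCoprime.abs_left_iff]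

/-! ### The product of the quartic symbols when the negative Pell equation is solvable. -/

/-- If the negative Pell equation for `p q` is solvable and `X² = p Y² + q Z²` with `Y` even,
then the product of the two quartic symbols is `1`. -/
theorem quarticSym_mul_quarticSym_of_even {p q : ℕ} [Fact p.Prime] [Fact q.Prime] (hpq : p ≠ q)
    (hp4 : p % 4 = 1) (hq4 : q % 4 = 1) {x y : ℤ} (hxy : x ^ 2 - p * q * y ^ 2 = -1)
    {X : ℕ} {Y Z : ℤ} (h : (X : ℤ) ^ 2 = p * Y ^ 2 + q * Z ^ 2) (hXY : IsCoprime (X : ℤ) Y)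
    (hXZ : IsCoprime (X : ℤ) Z) (hY : Even Y) : quarticSym q p * quarticSym p q = 1 := by
  have hpz := Nat.prime_iff_prime_int.1 (Fact.out : p.Prime)
  have hqz := Nat.prime_iff_prime_int.1 (Fact.out : q.Prime)
  have hpq' := natCast_not_dvd_natCast_of_prime_ne Fact.out Fact.out hpq
  have hqp' := natCast_not_dvd_natCast_of_prime_ne Fact.out Fact.out hpq.symm
  have hp2 := (Fact.out : p.Prime).two_le
  have hqY : ¬ (q : ℤ) ∣ Y := by
    intro h0
    have h1 : (q : ℤ) ∣ X := hqz.dvd_of_dvd_pow (n := 2)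
      (h ▸ dvd_add ((h0.pow two_ne_zero).mul_left _) (dvd_mul_right _ _))
    exact hqz.not_isUnit (hXY.isUnit_of_dvd' h1 h0)
  have hqX : ¬ (q : ℤ) ∣ X := by
    intro h0
    have h1 : (q : ℤ) ∣ p * Y ^ 2 := by
      rw [← Int.dvd_add_left (dvd_mul_right (q : ℤ) (Z ^ 2)), ← h]
      exact h0.pow two_ne_zero
    exact hqY (hqz.dvd_of_dvd_pow ((hqz.dvd_or_dvd h1).resolve_left hqp'))
  have hpZ : ¬ (p : ℤ) ∣ Z := by
    intro h0
    have h1 : (p : ℤ) ∣ X := hpz.dvd_of_dvd_pow (n := 2)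
      (h ▸ dvd_add (dvd_mul_right _ _) ((h0.pow two_ne_zero).mul_left _))
    exact hpz.not_isUnit (hXZ.isUnit_of_dvd' h1 h0)
  have hpX : ¬ (p : ℤ) ∣ X := by
    intro h0
    have h1 : (p : ℤ) ∣ q * Z ^ 2 := by
      rw [← Int.dvd_add_right (dvd_mul_right (p : ℤ) (Y ^ 2)), ← h]
      exact h0.pow two_ne_zero
    exact hpZ (hpz.dvd_of_dvd_pow ((hpz.dvd_or_dvd h1).resolve_left hpq'))
  have hXo : Odd (X : ℤ) := by
    by_contra h0
    exact Int.prime_two.not_isUnit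
      (hXY.isUnit_of_dvd' (Int.not_odd_iff_even.1 h0).two_dvd hY.two_dvd)
  have hXo' : Odd X := by exact_mod_cast hXo
  have hZo : Odd Z := by
    by_contra h0
    refine Int.not_even_iff_odd.2 (hXo.pow (n := 2)) ?_
    rw [h]
    exact ((hY.pow_of_ne_zero two_ne_zero).mul_left _).add
      (((Int.not_odd_iff_even.1 h0).pow_of_ne_zero two_ne_zero).mul_left _)
  -- X and Z are odd, so q ≡ 1 - pY² mod 8.
  have hmod8 : (q % 8 = 1 ∧ Y % 4 = 0) ∨ (q % 8 = 5 ∧ Y % 4 = 2) := by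
    obtain ⟨u, hu⟩ : ∃ u : ℤ, (p : ℤ) = 4 * u + 1 := ⟨p / 4, by omega⟩
    obtain ⟨y, hy⟩ := hY
    have hsq : ∀ {v : ℤ}, Odd v → ∃ s, v ^ 2 = 8 * s + 1 := by
      rintro v ⟨k, rfl⟩
      obtain ⟨c, hc⟩ := Int.even_mul_succ_self k
      exact ⟨c, by linear_combination 4 * hc⟩
    obtain ⟨s, hs⟩ := hsq hXo
    obtain ⟨t, ht⟩ := hsq hZo
    rw [hs, ht, hu, hy] at h
    rcases Int.even_or_odd' y with ⟨z, rfl | rfl⟩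
    · left
      have : (q : ℤ) = 8 * (s - q * t - (4 * u + 1) * 2 * z ^ 2) + 1 := by linear_combination -h
      omega
    · right
      have : (q : ℤ) = 8 * (s - q * t - (4 * u + 1) * 2 * (z ^ 2 + z) - 2 * u - 1) + 5 := by
        linear_combination -h
      omega
  have hJZ : J(Z | p) = 1 := jacobiSym_eq_one_of_odd hp4 hZo (u := Y) (v := X)
    ⟨-q * Z, by linear_combination -h⟩ hXZ
  -- Modulo X, -pq Y² ≡ (qZ)².
  have hJX : J(X | q) * J(X | p) = J(-1 | X) := by
    have h1 : J(-((p : ℤ) * q) | X) = 1 := by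
      refine jacobiSym_eq_one_of_dvd (u := Y) (v := q * Z) ⟨-q * X, by linear_combination q * h⟩ ?_
      exact (isCoprime_of_prime_not_dvd hqX).symm.mul_left hXZ.symm
    rw [← neg_one_mul, jacobiSym.mul_left, jacobiSym.mul_left] at h1
    rw [jacobiSym_natAbs_swap hq4 hXo, jacobiSym_natAbs_swap hp4 hXo, Int.natAbs_natCast]
    rcases jacobiSym.trichotomy (-1) X with h0 | h0 | h0 <;> rw [h0] at h1 ⊢ <;> linarith
  have hJ2Y : J(2 * Y | q) = 1 := by
    refine jacobiSym_two_mul_eq_one_of_even hq4 (fun h0 => hqY (h0 ▸ dvd_zero _)) hY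
      (hmod8.imp And.left And.right) (u := Z) (v := X) ⟨-p * Y, by linear_combination -h⟩ hXY
  obtain ⟨a, b, hab, hao, hbe⟩ : ∃ a b : ℤ, a ^ 2 + b ^ 2 = p ∧ Odd a ∧ Even b := by
    obtain ⟨a, b, hab⟩ := Nat.Prime.sq_add_sq (p := p) (by omega)
    have hab' : (a : ℤ) ^ 2 + (b : ℤ) ^ 2 = p := by exact_mod_cast hab
    have hodd : Odd ((a : ℤ) ^ 2 + (b : ℤ) ^ 2) := by rw [hab', Int.odd_iff]; omega
    rcases Int.even_or_odd (a : ℤ) with ha | ha <;> rcases Int.even_or_odd (b : ℤ) with hb | hb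
    · exact absurd ((ha.pow_of_ne_zero two_ne_zero).add (hb.pow_of_ne_zero two_ne_zero))
        (Int.not_even_iff_odd.2 hodd)
    · exact ⟨b, a, by rw [add_comm, hab'], hb, ha⟩
    · exact ⟨a, b, hab', ha, hb⟩
    · exact absurd (ha.pow.add_odd hb.pow) (Int.not_even_iff_odd.2 hodd)
  -- The sign of a is free: if q divided both X + aY and X - aY, it would divide 2X.
  obtain ⟨a, hab, hao, hqW⟩ : ∃ a : ℤ, a ^ 2 + b ^ 2 = p ∧ Odd a ∧ ¬ (q : ℤ) ∣ X + a * Y := by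
    by_cases h0 : (q : ℤ) ∣ X + a * Y
    · refine ⟨-a, by rw [neg_sq, hab], hao.neg, fun h1 => ?_⟩
      have h2 : (q : ℤ) ∣ 2 * X := by
        have : (2 * X : ℤ) = (X + a * Y) + (X + -a * Y) := by ring
        rw [this]
        exact dvd_add h0 h1
      refine hqX ((hqz.dvd_or_dvd h2).resolve_left fun h3 => ?_)
      have := Int.le_of_dvd two_pos h3
      have := (Fact.out : q.Prime).two_le
      omega
    · exact ⟨a, hab, hao, h0⟩
  have hpa : ¬ (p : ℤ) ∣ a := by
    rintro ⟨c, rfl⟩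
    have hc : c ≠ 0 := by rintro rfl; simp at hao
    have hc1 : 1 ≤ c ^ 2 := by have := sq_nonneg c; have := pow_ne_zero 2 hc; omega
    have hp2' : (2 : ℤ) ≤ p := by exact_mod_cast hp2
    nlinarith [sq_nonneg b, mul_nonneg (sq_nonneg (p : ℤ)) (sub_nonneg.2 hc1)]
  -- (a - bx)(a + bx) = p(1 - q(by)²), so after a choice of sign p ∣ a - bx. Then a + bx, prime to
  -- p, divides 1 - q(by)².
  obtain ⟨x, hxy, hpV⟩ : ∃ x : ℤ, x ^ 2 - p * q * y ^ 2 = -1 ∧ (p : ℤ) ∣ a - b * x := by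
    have h1 : (p : ℤ) ∣ (a - b * x) * (a + b * x) :=
      ⟨1 - b ^ 2 * q * y ^ 2, by linear_combination hab - b ^ 2 * hxy⟩
    rcases hpz.dvd_or_dvd h1 with h1 | h1
    · exact ⟨x, hxy, h1⟩
    · exact ⟨-x, by rw [neg_sq, hxy], by simpa using h1⟩
  have hJV : J(a + b * x | q) = 1 := by
    have hpV' : ¬ (p : ℤ) ∣ a + b * x := by
      intro h1
      have h2 : (p : ℤ) ∣ 2 * a := by
        have : 2 * a = (a - b * x) + (a + b * x) := by ring
        rw [this]
        exact dvd_add hpV h1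
      refine hpa ((hpz.dvd_or_dvd h2).resolve_left fun h3 => ?_)
      have := Int.le_of_dvd two_pos h3
      omega
    have h1 : a + b * x ∣ 1 - b ^ 2 * q * y ^ 2 := by
      refine (isCoprime_of_prime_not_dvd hpV').dvd_of_dvd_mul_left ⟨a - b * x, ?_⟩
      linear_combination -hab + b ^ 2 * hxy
    refine jacobiSym_eq_one_of_odd hq4 (hao.add_even (hbe.mul_right x)) (u := b * y) (v := 1) ?_
      isCoprime_one_left
    have : (q : ℤ) * (b * y) ^ 2 - 1 ^ 2 = -(1 - b ^ 2 * q * y ^ 2) := by ring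
    rw [this]
    exact h1.neg_right
  have hW0 : 0 < (X : ℤ) + a * Y := by
    have hX0 : (0 : ℤ) < X := by exact_mod_cast hXo'.pos
    have hZ0 : 0 < Z ^ 2 := by
      have : Z ≠ 0 := by rintro rfl; simp at hZo
      positivity
    have hq0 : (0 : ℤ) < q := by exact_mod_cast (Fact.out : q.Prime).pos
    have h1 : (-(a * Y)) ^ 2 < (X : ℤ) ^ 2 := by
      rw [h, ← hab]
      nlinarith [sq_nonneg (b * Y), mul_pos hq0 hZ0]
    have := lt_of_pow_lt_pow_left₀ 2 hX0.le h1
    linarith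
  obtain ⟨w, hw⟩ := Int.eq_ofNat_of_zero_le hW0.le
  have hwo : Odd (w : ℤ) := hw ▸ hXo.add_even (hY.mul_left a)
  -- Key congruence: (w + bxY)² - 2Yw(a + bx) = qZ² + b²Y²(1 + x²), and 1 + x² = pq y².
  have hJw : J(w | q) = 1 := by
    have h1 : J(2 * Y * w * (a + b * x) | q) = J((w + b * x * Y) ^ 2 | q) := by
      refine jacobiSym_eq_of_dvd_sub ⟨-(Z ^ 2 + b ^ 2 * Y ^ 2 * p * y ^ 2), ?_⟩
      rw [← hw]
      linear_combination -h + Y ^ 2 * hab - b ^ 2 * Y ^ 2 * hxy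
    rw [jacobiSym.mul_left, jacobiSym.mul_left, hJ2Y, hJV, jacobiSym.pow_left] at h1
    have h2 := jacobiSym_sq_eq_one (hw ▸ hqW)
    rcases jacobiSym.trichotomy w q with h0 | h0 | h0
    · rw [h0] at h2; norm_num at h2
    · exact h0
    · rw [h0] at h1
      nlinarith [sq_nonneg J(w + b * x * Y | q)]
  -- By reciprocity (q/w) = 1, and w(X - aY) = (bY)² + qZ² gives (q/w) = (-1/w).
  have hJw' : J(-1 | w) = 1 := by
    rw [jacobiSym_natAbs_swap hq4 hwo, Int.natAbs_natCast] at hJw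
    refine Eq.trans (Eq.symm ?_) hJw
    refine jacobiSym_eq_neg_one_of_mul_eq w (X - a * Y) (b * Y) Z (by exact_mod_cast hwo) ?_ ?_ ?_
    · exact Nat.isCoprime_iff_coprime.1 (isCoprime_of_prime_not_dvd (hw ▸ hqW))
    · rw [← hw]
      linear_combination h - Y ^ 2 * hab
    · intro l hl hlw hlZ hlw'
      have hlz := Nat.prime_iff_prime_int.1 hl
      have hlw : (l : ℤ) ∣ X + a * Y := hw ▸ Int.natCast_dvd_natCast.2 hlw
      have h2 : (l : ℤ) ∣ 2 * X := by
        have : (2 * X : ℤ) = (X + a * Y) + (X - a * Y) := by ring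
        rw [this]
        exact dvd_add hlw hlw'
      rcases hlz.dvd_or_dvd h2 with h3 | h3
      · have hl2 : l = 2 := (Nat.prime_dvd_prime_iff_eq hl Nat.prime_two).1
          (by exact_mod_cast h3)
        subst hl2
        rw [hw] at hlw
        exact Int.not_even_iff_odd.2 hwo (even_iff_two_dvd.2 (by exact_mod_cast hlw))
      · exact hlz.not_isUnit (hXZ.isUnit_of_dvd' h3 hlZ)
  have hw4 : w % 4 = 1 := by
    rw [jacobiSym.at_neg_one (by exact_mod_cast hwo), ZMod.χ₄_nat_eq_if_mod_four] at hJw'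
    by_contra h0
    rw [if_neg h0] at hJw'
    split_ifs at hJw'; norm_num at hJw'
  obtain ⟨c, hc⟩ := hao
  obtain ⟨d, hd⟩ := hY
  -- Since a is odd and Y even, X ≡ w - Y ≡ 1 - Y mod 4. Hence (-1/X) and (Y/q) = (2/q) are both 1
  -- if 4 ∣ Y, and both -1 otherwise.
  have hwX : (w : ℤ) = X + Y + 4 * (c * d) := by rw [← hw, hc, hd]; ring
  rw [quarticSym_eq_jacobiSym hq4 ⟨Z ^ 2, by linear_combination h⟩ hqX hqY,
    quarticSym_eq_jacobiSym hp4 ⟨Y ^ 2, by linear_combination h⟩ hpX hpZ, hJZ, mul_one,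
    mul_right_comm, hJX, jacobiSym.at_neg_one hXo']
  rw [jacobiSym.mul_left] at hJ2Y
  rcases hmod8 with ⟨h8, hY4⟩ | ⟨h8, hY4⟩
  · rw [jacobiSym_two_of_mod_eight_one h8, one_mul] at hJ2Y
    rw [hJ2Y, ZMod.χ₄_nat_one_mod_four (by omega), one_mul]
  · rw [jacobiSym_two_of_mod_eight_five h8] at hJ2Y
    rw [ZMod.χ₄_nat_three_mod_four (by omega)]
    linarith

/-- Y and Z cannot both be odd, as X² would be 2 mod 4. The case of even Z follows by exchanging p
and q. -/
theorem quarticSym_mul_quarticSym_of_neg_pell {p q : ℕ} [Fact p.Prime] [Fact q.Prime]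
    (hpq : p ≠ q) (hp4 : p % 4 = 1) (hq4 : q % 4 = 1) (h1 : J(p | q) = 1) {x y : ℤ}
    (hxy : x ^ 2 - p * q * y ^ 2 = -1) : quarticSym q p * quarticSym p q = 1 := by
  have h2 : J(q | p) = 1 := by
    rw [← h1, jacobiSym.quadratic_reciprocity_one_mod_four hq4 (Nat.odd_iff.2 (by omega))]
  obtain ⟨X, Y, Z, h, hXY, hXZ⟩ := exists_coprime_sq_eq_prime_mul_sq_add hpq h1 h2
  rcases Int.even_or_odd Y with hY | hY
  · exact quarticSym_mul_quarticSym_of_even hpq hp4 hq4 hxy h hXY hXZ hY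
  rcases Int.even_or_odd Z with hZ | hZ
  · rw [mul_comm]
    exact quarticSym_mul_quarticSym_of_even hpq.symm hq4 hp4 (x := x) (y := y)
      (by rw [mul_comm (q : ℤ), hxy]) (by rw [h, add_comm]) hXZ hXY hZ
  · exfalso
    obtain ⟨u, hu⟩ : ∃ u : ℤ, (p : ℤ) = 4 * u + 1 := ⟨p / 4, by omega⟩
    obtain ⟨v, hv⟩ : ∃ v : ℤ, (q : ℤ) = 4 * v + 1 := ⟨q / 4, by omega⟩
    obtain ⟨s, rfl⟩ := hY
    obtain ⟨t, rfl⟩ := hZ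
    rw [hu, hv] at h
    have h3 : (X : ℤ) ^ 2 = 4 * ((4 * u + 1) * (s ^ 2 + s) + u + (4 * v + 1) * (t ^ 2 + t) + v)
      + 2 := by linear_combination h
    rcases Int.even_or_odd' (X : ℤ) with ⟨r, hr | hr⟩
    · have : (X : ℤ) ^ 2 = 4 * r ^ 2 := by rw [hr]; ring
      omega
    · have : (X : ℤ) ^ 2 = 4 * (r ^ 2 + r) + 1 := by rw [hr]; ring
      omega

/-! ### Passage between discriminant 4n + 1 and x² - m y² = -1, and the conclusion. -/

theorem negativePellSolvable_of_sq_sub {n m r s : ℤ} (hm : m = 4 * n + 1)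
    (h : s ^ 2 - m * r ^ 2 = -1) : NegativePellSolvable n := by
  refine ⟨s + r, 2 * r, ?_⟩
  rw [principalForm]
  subst hm
  linear_combination h

/-- The cube of the unit (x + U√m)/2 of norm -1 lies in ℤ[√m]. By mU² = x² + 4 its coordinates are
x(x² + 3)/2 and U(x² + 1)/2. -/
theorem NegativePellSolvable.exists_sq_sub {n m : ℤ} (hm : m = 4 * n + 1)
    (h : NegativePellSolvable n) : ∃ x y : ℤ, x ^ 2 - m * y ^ 2 = -1 := by
  obtain ⟨T, U, h⟩ := h
  rw [principalForm] at h
  have h4 : (2 * T - U) ^ 2 - m * U ^ 2 = -4 := by subst hm; linear_combination 4 * h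
  generalize 2 * T - U = x at h4
  obtain ⟨c, hc⟩ : (2 : ℤ) ∣ x * (x ^ 2 + 3) := by
    rcases Int.even_or_odd' x with ⟨z, rfl | rfl⟩
    · exact ⟨z * ((2 * z) ^ 2 + 3), by ring⟩
    · exact ⟨(2 * z + 1) * (2 * z ^ 2 + 2 * z + 2), by ring⟩
  obtain ⟨d, hd⟩ : (2 : ℤ) ∣ U * (x ^ 2 + 1) := by
    rcases Int.even_or_odd' x with ⟨z, rfl | rfl⟩
    · refine Dvd.dvd.mul_right (Int.prime_two.dvd_of_dvd_pow (n := 2)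
        ⟨2 * z ^ 2 + 2 - 2 * n * U ^ 2, ?_⟩) _
      subst hm
      linear_combination -h4
    · exact ⟨U * (2 * z ^ 2 + 2 * z + 1), by ring⟩
  refine ⟨c, d, mul_left_cancel₀ (four_ne_zero : (4 : ℤ) ≠ 0) ?_⟩
  linear_combination -(x * (x ^ 2 + 3) + 2 * c) * hc + m * (U * (x ^ 2 + 1) + 2 * d) * hd +
    (x ^ 2 + 1) ^ 2 * h4

theorem mainTheorem5 (p q : ℕ) [Fact p.Prime] [Fact q.Prime]
    (hp : p % 4 = 1) (hq : q % 4 = 1)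
    (n : ℤ) (hn : (p : ℤ) * (q : ℤ) = 4 * n + 1) :
    (legendreSym q p = -1 → NegativePellSolvable n) ∧
    (legendreSym q p = 1 →
      (quarticSym q p = -quarticSym p q → ¬ NegativePellSolvable n) ∧
      (quarticSym q p = -1 ∧ quarticSym p q = -1 → NegativePellSolvable n)) := by
  -- Distinctness of p and q is not assumed; it follows because (p/p) = 0.
  have hpq : ∀ {e : ℤ}, e ≠ 0 → legendreSym q p = e → p ≠ q := by
    rintro e he h rfl
    rw [(legendreSym.eq_zero_iff p p).2 (by simp)] at h
    exact he h.symm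
  have hrec : J(p | q) = J(q | p) :=
    jacobiSym.quadratic_reciprocity_one_mod_four hp (Nat.odd_iff.2 (by omega))
  refine ⟨fun h => ?_, fun h => ⟨fun h4 hs => ?_, fun h4 => ?_⟩⟩
  · have hne := hpq (by norm_num) h
    rw [jacobiSym.legendreSym.to_jacobiSym] at h
    obtain ⟨r, s, h1 | h1 | h1⟩ := exists_neg_pell_or Fact.out Fact.out hne hp hq
    · exact negativePellSolvable_of_sq_sub hn h1
    · have := (quarticSym_eq_one_of_pell_form hq hp h1).1
      rw [h] at this
      norm_num at this
    · have := (quarticSym_eq_one_of_pell_form hp hq h1).1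
      rw [← hrec, h] at this
      norm_num at this
  · have hne := hpq (by norm_num) h
    rw [jacobiSym.legendreSym.to_jacobiSym] at h
    obtain ⟨x, y, hxy⟩ := hs.exists_sq_sub hn
    have := quarticSym_mul_quarticSym_of_neg_pell hne hp hq h hxy
    rw [h4] at this
    nlinarith [sq_nonneg (quarticSym p q)]
  · have hne := hpq (by norm_num) h
    obtain ⟨r, s, h1 | h1 | h1⟩ := exists_neg_pell_or Fact.out Fact.out hne hp hq
    · exact negativePellSolvable_of_sq_sub hn h1
    · have := (quarticSym_eq_one_of_pell_form hq hp h1).2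
      rw [h4.1] at this
      norm_num at this
    · have := (quarticSym_eq_one_of_pell_form hp hq h1).2
      rw [h4.2] at this
      norm_num at this
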